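/- For a positive integer $n$, let $\mathrm{PF}(n)$ be the set of parking functions of length $n$, i.e. sequences $\pi=(\pi_1,\ldots,\pi_n)$ of positive integers whose weakly increasing rearrangement $b_1\le\cdots\le b_n$ satisfies $b_j\le j$ for all $j$. For $\pi\in\mathrm{PF}(n)$ put $$\mathrm{cosum}(\pi)=\binom{n+1}{2}-\sum_{i=1}^n\pi_i,\qquad \mathrm{exced}(\pi)=|\{i\in\{1,\ldots,n\}:\pi_i>i\}|,$$ and define the polynomial $$\widetilde I_n(q,t)=\sum_{\pi\in\mathrm{PF}(n)}q^{\mathrm{cosum}(\pi)}t^{\mathrm{exced}(\pi)}\in\mathbb Z[q,t].$$ For a permutation $w\in\mathfrak S_n$, let $\mathrm{des}_1(w)$ be the number of big descents of $w$, i.e. of indices $i\in\{1,\ldots,n-1\}$ with $w(i)>w(i+1)+1$, and let $\mathrm{Alt}_n$ be the set of up-down alternating permutations $w\in\mathfrak S_n$, i.e. those with $w(1)<w(2)>w(3)<\cdots$. Then for every $n\ge 2$, $$\widetilde I_n(-1,t)=\sum_{w\in\mathrm{Alt}_n}t^{\mathrm{des}_1(w^{-1})+1}\quad\text{in }\mathbb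 Z[t].$$ -/

import Mathlib

open Polynomial

/-- A parking function of length `n`: a sequence of positive integers whose weakly increasing
rearrangement `b` satisfies `b_j ≤ j` for all `j ∈ {1, …, n}`. Positions are indexed by `Fin n`, so
the position `j : Fin n` is the `(j + 1)`-st one; `π ∘ Tuple.sort π` is the weakly increasing
rearrangement of `π`. -/
def IsParkingFunction {n : ℕ} (π : Fin n → ℕ) : Prop :=
  (∀ i, 1 ≤ π i) ∧ ∀ j : Fin n, π (Tuple.sort π j) ≤ (j : ℕ) + 1

instance {n : ℕ} (π : Fin n → ℕ) : Decidable (IsParkingFunction π) := by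
  unfold IsParkingFunction; infer_instance

/-- The finite set of all parking functions of length `n` (see `mem_parkingFunctions`). -/
def parkingFunctions (n : ℕ) : Finset (Fin n → ℕ) :=
  (Fintype.piFinset fun _ : Fin n => Finset.Icc 1 n).filter fun π => IsParkingFunction π

theorem mem_parkingFunctions {n : ℕ} (π : Fin n → ℕ) :
    π ∈ parkingFunctions n ↔ IsParkingFunction π := by
  simp only [parkingFunctions, Finset.mem_filter, Fintype.mem_piFinset, Finset.mem_Icc,
    and_iff_right_iff_imp]
  intro h i
  refine ⟨h.1 i, ?_⟩
  have h2 := h.2 ((Tuple.sort π).symm i)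
  have h3 := ((Tuple.sort π).symm i).isLt
  simp only [Equiv.apply_symm_apply] at h2
  omega

/-- `cosum π = binom(n+1, 2) - ∑ π_i`. For parking functions the subtraction does not truncate, see
`cosum_add_sum`. -/
def cosum {n : ℕ} (π : Fin n → ℕ) : ℕ := (n + 1).choose 2 - ∑ i, π i

theorem cosum_add_sum {n : ℕ} (π : Fin n → ℕ) (h : IsParkingFunction π) :
    cosum π + ∑ i, π i = (n + 1).choose 2 := by
  have h1 : ∑ i, π i ≤ ∑ j : Fin n, ((j : ℕ) + 1) := by
    rw [← Equiv.sum_comp (Tuple.sort π) π]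
    exact Finset.sum_le_sum fun j _ => h.2 j
  have h2 : ∑ j : Fin n, ((j : ℕ) + 1) = (n + 1).choose 2 := by
    rw [Fin.sum_univ_eq_sum_range (fun j => j + 1) n, Nat.choose_two_right, ← Finset.sum_range_id,
      Finset.sum_range_succ', add_zero]
  unfold cosum
  omega

/-- The number of strict excedances of `π`, i.e. of positions `i ∈ {1, …, n}` with `π_i > i`. -/
def exced {n : ℕ} (π : Fin n → ℕ) : ℕ :=
  (Finset.univ.filter fun i : Fin n => (i : ℕ) + 1 < π i).card

/-- The two-variable polynomial `Ĩ_n(q, t) = ∑_{π ∈ PF(n)} q^{cosum π} t^{exced π}`, as a polynomial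
in the outer variable `q` whose coefficients are polynomials in `t`. -/
noncomputable def parkingEnumerator (n : ℕ) : ℤ[X][X] :=
  ∑ π ∈ parkingFunctions n, X ^ cosum π * C (X ^ exced π)

/-- The number of big descents of `w`: indices `i ∈ {1, …, n-1}` with `w(i) > w(i+1) + 1`. -/
def bigDes {n : ℕ} (w : Equiv.Perm (Fin n)) : ℕ :=
  (Finset.univ.filter fun i : Fin n =>
    ∃ h : (i : ℕ) + 1 < n, (w ⟨(i : ℕ) + 1, h⟩ : ℕ) + 1 < (w i : ℕ)).card

/-- `w` is up-down alternating: `w_1 < w_2 > w_3 < ⋯`. As positions start from `0` here, the ascents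
are at the even positions. -/
def IsUpDown {n : ℕ} (w : Equiv.Perm (Fin n)) : Prop :=
  ∀ (i : Fin n) (h : (i : ℕ) + 1 < n),
    (Even (i : ℕ) → w i < w ⟨(i : ℕ) + 1, h⟩) ∧ (Odd (i : ℕ) → w ⟨(i : ℕ) + 1, h⟩ < w i)

instance {n : ℕ} (w : Equiv.Perm (Fin n)) : Decidable (IsUpDown w) := by
  unfold IsUpDown; infer_instance

/-- The up-down alternating permutations in the symmetric group on `n` letters. -/
def alternatingPerms (n : ℕ) : Finset (Equiv.Perm (Fin n)) :=
  Finset.univ.filter fun w => IsUpDown w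

/-! Both sides have degree at most `n` in `t`, so it suffices that the functionals `t ^ k ↦ (x +
k).choose n` agree on them for every natural number `x` (`eq_of_binomialFunctional_eq`).

On the parking side, `(x + exced π).choose n` counts the `n`-subsets `T` of a set of `x + exced π`
slots. Moving the letters of `π` onto `T` turns the pairs `(π, T)` into fillings of `x + n` slots
with exactly `x` slots left unassigned. The parking condition and the sign depend only on the
numbers of small values, so they survive the move. Building a filling one value at a time, only the
number `u` of unassigned slots matters. It starts and ends at `x`, and a step from `u` to `u'` has
weight `(-1) ^ (x - u') * u.choose (u' - 1)`. The signed sum is thus a diagonal entry of a matrix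
power (`sum_parkingFunctions_choose`).

On the permutation side, stable sorting groups the down-up words on `x + 1` letters by alternating
permutation, and the group of `w` has `(x + 1 + bigDes w⁻¹).choose n` elements
(`sum_alternatingPerms_choose`). Reversing the letters at every other position turns these words
into words whose adjacent letters sum to less than `x`.

The two counts agree because the transfer matrix is the summation operator `f ↦ (i ↦ ∑ b < x - i, f
b)` written in the basis `(-1) ^ l * i.choose l` (`zigzagCount_eq_sum`). -/

/-! ### A transfer recursion and the counting of zigzag words -/

/-- The sum is an `i`-fold backward difference of `y ↦ y.choose r` at `x`. Pascal's rule on `i`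
splits it into the cases `(x, i)` and `(x - 1, i)`, and Pascal's rule on the right-hand side
matches. Any `M > i` gives the same sum, which leaves callers free to choose the range. -/
theorem sum_range_neg_one_pow_mul_choose_mul_choose (i : ℕ) : ∀ x r M : ℕ, i < M → i ≤ x → r ≤ x →
    ∑ l ∈ Finset.range M, (-1 : ℤ) ^ l * i.choose l * (x - l).choose r = (x - i).choose (x - r) := by
  induction i with
  | zero =>
    intro x r M hM hx hr
    rw [Finset.sum_eq_single_of_mem 0 (by simpa using hM)]
    · simp [Nat.choose_symm hr]
    · intro l _ hl
      simp [Nat.choose_eq_zero_of_lt (Nat.pos_of_ne_zero hl)]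
  | succ i ih =>
    intro x r M hM hx hr
    obtain ⟨M, rfl⟩ : ∃ M', M = M' + 1 := ⟨M - 1, by omega⟩
    obtain ⟨x, rfl⟩ : ∃ x', x = x' + 1 := ⟨x - 1, by omega⟩
    have h1 := ih (x + 1) r (M + 1) (by omega) (by omega) hr
    have key : ∑ l ∈ Finset.range (M + 1),
          (-1 : ℤ) ^ l * (i + 1).choose l * (x + 1 - l).choose r =
        ∑ l ∈ Finset.range (M + 1), (-1 : ℤ) ^ l * i.choose l * (x + 1 - l).choose r -
        ∑ l ∈ Finset.range M, (-1 : ℤ) ^ l * i.choose l * (x - l).choose r := by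
      rw [Finset.sum_range_succ', Finset.sum_range_succ' (n := M), add_sub_right_comm,
        ← Finset.sum_sub_distrib]
      simp only [Nat.choose_zero_right]
      congr 1
      refine Finset.sum_congr rfl fun l _ => ?_
      rw [Nat.choose_succ_succ, Nat.add_sub_add_right]
      push_cast
      ring
    rw [key, h1]
    have e : x + 1 - (i + 1) = x - i := by omega
    have e' : x + 1 - i = (x - i) + 1 := by omega
    rcases Nat.lt_or_ge x r with h | h
    · have : r = x + 1 := by omega
      subst this
      rw [Finset.sum_eq_zero]
      · simp
      · intro l _
        rw [Nat.choose_eq_zero_of_lt (by omega : x - l < x + 1)]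
        simp
    · rw [ih x r M (by omega) (by omega) h, e, e', show x + 1 - r = (x - r) + 1 by omega,
        Nat.choose_succ_succ]
      push_cast
      ring

/-- The entries of the column indexed by `x` of the `k`-th power of the matrix with entries
`(-1) ^ (x - u') * (u.choose (u' - 1))`, for `u' ∈ {1, …, x}`. -/
def transferPow (x : ℕ) : ℕ → ℕ → ℤ
  | 0, u => if u = x then 1 else 0
  | k + 1, u =>
    ∑ l ∈ Finset.range x, (-1) ^ l * (u.choose (x - 1 - l)) * transferPow x k (x - l)

/-- The number of words `a` of length `k + 1` in `ℕ` with first letter `i` all of whose pairs of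
adjacent letters have a sum less than `x`. -/
def zigzagCount (x : ℕ) : ℕ → ℕ → ℕ
  | 0, _ => 1
  | k + 1, i => ∑ b ∈ Finset.range (x - i), zigzagCount x k b

theorem sum_range_choose_fixed (m l : ℕ) :
    ∑ b ∈ Finset.range m, b.choose l = m.choose (l + 1) := by
  induction m with
  | zero => simp
  | succ m ih => rw [Finset.sum_range_succ, ih, Nat.choose_succ_succ, add_comm]

/-- Prepending a letter applies the operator `f ↦ (i ↦ ∑ b < x - i, f b)`. It sends `b.choose l` to
`(x - i).choose (l + 1)`, and the alternating identity above expands this again in the `i.choose j`;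
the resulting coefficients are those of the `transferPow` recursion. -/
theorem zigzagCount_eq_sum (x k : ℕ) : ∀ i < x, (zigzagCount x k i : ℤ) =
    ∑ l ∈ Finset.range x, (-1) ^ l * transferPow x k (x - l) * i.choose l := by
  induction k with
  | zero =>
    intro i hi
    rw [Finset.sum_eq_single_of_mem 0 (by simp; omega)]
    · simp [zigzagCount, transferPow]
    · intro l h1 h2
      have : x - l ≠ x := by simp at h1; omega
      simp [transferPow, this]
  | succ k ih =>
    intro i hi
    have h1 : (zigzagCount x (k + 1) i : ℤ) = ∑ l ∈ Finset.range x,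
        (-1) ^ l * transferPow x k (x - l) * (x - i).choose (l + 1) := by
      simp only [zigzagCount]
      push_cast
      rw [Finset.sum_congr rfl fun b hb => ih b (by simp at hb; omega), Finset.sum_comm]
      refine Finset.sum_congr rfl fun l _ => ?_
      rw [← Finset.mul_sum, ← sum_range_choose_fixed]
      push_cast
      rfl
    rw [h1]
    simp only [transferPow, Finset.mul_sum, Finset.sum_mul]
    rw [Finset.sum_comm]
    refine Finset.sum_congr rfl fun l hl => ?_
    have hl' := Finset.mem_range.1 hl
    -- The alternating identity is used from right to left with `r = x - 1 - l`.
    rw [show l + 1 = x - (x - 1 - l) by omega,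
      ← sum_range_neg_one_pow_mul_choose_mul_choose i x (x - 1 - l) x hi hi.le (by omega),
      Finset.mul_sum]
    exact Finset.sum_congr rfl fun j _ => by ring

theorem zigzagCount_zero_eq_transferPow (x k : ℕ) :
    (zigzagCount x (k + 1) 0 : ℤ) = transferPow x (k + 1) x := by
  rcases Nat.eq_zero_or_pos x with rfl | hx
  · simp [zigzagCount, transferPow]
  · rw [zigzagCount_eq_sum x _ 0 hx, Finset.sum_eq_single_of_mem 0 (by simpa using hx)]
    · simp
    · intro l _ hl
      simp [Nat.choose_eq_zero_of_lt (Nat.pos_of_ne_zero hl)]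

/-! ### Comparing polynomials through binomial coefficients -/

/-- The linear functional `X ^ k ↦ (x + k).choose n` on polynomials of degree at most `n`. -/
noncomputable def binomialFunctional (n x : ℕ) : ℤ[X] →ₗ[ℤ] ℤ :=
  ∑ k ∈ Finset.range (n + 1), ((x + k).choose n : ℤ) • lcoeff ℤ k

theorem binomialFunctional_apply (n x : ℕ) (p : ℤ[X]) : binomialFunctional n x p =
    ∑ k ∈ Finset.range (n + 1), ((x + k).choose n : ℤ) * p.coeff k := by
  simp [binomialFunctional]

theorem binomialFunctional_X_pow {n k : ℕ} (x : ℕ) (hk : k ≤ n) :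
    binomialFunctional n x (X ^ k) = (x + k).choose n := by
  rw [binomialFunctional_apply, Finset.sum_eq_single_of_mem k (by simp; omega)]
  · simp
  · intro j _ hj
    simp [coeff_X_pow, hj]

/-- The system is triangular: `(x + k).choose n` vanishes for `k < n - x` and is `1` for `k = n -
x`. Taking `x = 0, 1, …, n` kills the coefficients of `p - q` from the top down. -/
theorem eq_of_binomialFunctional_eq {n : ℕ} {p q : ℤ[X]} (hp : p.natDegree ≤ n)
    (hq : q.natDegree ≤ n) (h : ∀ x, binomialFunctional n x p = binomialFunctional n x q) :
    p = q := by
  rw [← sub_eq_zero]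
  set r := p - q with hr
  have hdeg : r.natDegree ≤ n := (natDegree_sub_le p q).trans (max_le hp hq)
  have h0 : ∀ x, ∑ k ∈ Finset.range (n + 1), ((x + k).choose n : ℤ) * r.coeff k = 0 := fun x => by
    rw [← binomialFunctional_apply, hr, map_sub, h, sub_self]
  have key : ∀ x ≤ n, r.coeff (n - x) = 0 := by
    intro x
    induction x using Nat.strong_induction_on with
    | _ x ih =>
      intro hx
      have := h0 x
      rw [Finset.sum_eq_single_of_mem (n - x) (by simp)] at this
      · simpa [show x + (n - x) = n by omega] using this
      · intro k hk hne
        rw [Finset.mem_range] at hk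
        rcases Nat.lt_or_ge k (n - x) with h | h
        · simp [Nat.choose_eq_zero_of_lt (by omega : x + k < n)]
        · have := ih (n - k) (by omega) (by omega)
          rw [show n - (n - k) = k by omega] at this
          simp [this]
  ext k
  rcases Nat.lt_or_ge n k with hk | hk
  · simpa using coeff_eq_zero_of_natDegree_lt (lt_of_le_of_lt hdeg hk)
  · simpa [show n - (n - k) = k by omega] using key (n - k) (by omega)

/-! ### Parking functions through counts of small values -/

theorem isParkingFunction_iff_le_card {n : ℕ} (π : Fin n → ℕ) : IsParkingFunction π ↔
    (∀ i, 1 ≤ π i) ∧ ∀ k < n, k + 1 ≤ (Finset.univ.filter fun i => π i ≤ k + 1).card := by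
  refine and_congr_right fun _ => ?_
  have h (k : ℕ) (hk : k < n) : π (Tuple.sort π ⟨k, hk⟩) ≤ k + 1 ↔
      k + 1 ≤ (Finset.univ.filter fun i => π i ≤ k + 1).card := by
    have h1 := Tuple.lt_card_le_iff_apply_le_of_monotone (j := ⟨k, hk⟩) (a := k + 1)
      (Tuple.monotone_sort π)
    simp only [Function.comp_apply] at h1
    rw [← h1, Nat.succ_le_iff]
    refine iff_of_eq (congrArg _ (Finset.card_bij (fun i _ => Tuple.sort π i) ?_ ?_ ?_))
    · simp
    · simp
    · intro b hb
      exact ⟨(Tuple.sort π).symm b, by simpa using hb, by simp⟩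
  exact ⟨fun H k hk => (h k hk).1 (H ⟨k, hk⟩), fun H j => (h j j.2).2 (H j j.2)⟩

/-- `(-1) ^ (N - k)` if `k ≤ N`, and zero otherwise. -/
def excessSign (k N : ℕ) : ℤ := if k ≤ N then (-1) ^ (N - k) else 0

/-- This writes the sign `(-1) ^ cosum π` as a product over thresholds, which can then be
accumulated value by value. -/
theorem cosum_eq_sum {n : ℕ} (π : Fin n → ℕ) (h : IsParkingFunction π) : cosum π =
    ∑ k ∈ Finset.range n, ((Finset.univ.filter fun i => π i ≤ k + 1).card - (k + 1)) := by
  have hle : ∀ i, π i ≤ n := fun i => by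
    have := (mem_parkingFunctions π).2 h
    simp only [parkingFunctions, Finset.mem_filter, Fintype.mem_piFinset, Finset.mem_Icc] at this
    exact (this.1 i).2
  have h1 := ((isParkingFunction_iff_le_card π).1 h).2
  have h2 : ∑ k ∈ Finset.range n, (Finset.univ.filter fun i => π i ≤ k + 1).card + ∑ i, π i =
      n * (n + 1) := by
    simp only [Finset.card_filter]
    -- Double counting: the letter `π i` lies below `n + 1 - π i` of the thresholds, so together
    -- with its own value it contributes `n + 1`.
    rw [Finset.sum_comm, ← Finset.sum_add_distrib, Finset.sum_congr rfl (g := fun _ => n + 1)]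
    · simp
    · intro i _
      have e : (Finset.range n).filter (fun k => π i ≤ k + 1) = Finset.Ico (π i - 1) n := by
        ext k
        simp
        omega
      rw [← Finset.card_filter, e, Nat.card_Ico]
      have := h.1 i
      have := hle i
      omega
  have h3 : ∑ k ∈ Finset.range n, (k + 1) = (n + 1).choose 2 := by
    rw [Nat.choose_two_right, ← Finset.sum_range_id, Finset.sum_range_succ', add_zero]
  have h4 : (n + 1).choose 2 * 2 = n * (n + 1) := by
    rw [Nat.choose_two_right, Nat.add_sub_cancel, Nat.div_mul_cancel, mul_comm]
    exact (Nat.even_mul_pred_self (n + 1)).two_dvd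
  have h5 : ∑ k ∈ Finset.range n,
      ((Finset.univ.filter fun i => π i ≤ k + 1).card - (k + 1)) + ∑ k ∈ Finset.range n, (k + 1) =
      ∑ k ∈ Finset.range n, (Finset.univ.filter fun i => π i ≤ k + 1).card := by
    rw [← Finset.sum_add_distrib]
    refine Finset.sum_congr rfl fun k hk => ?_
    have := h1 k (Finset.mem_range.1 hk)
    omega
  have h6 := cosum_add_sum π h
  omega

theorem prod_excessSign_eq {n : ℕ} (π : Fin n → ℕ) (h : ∀ i, 1 ≤ π i) :
    ∏ k ∈ Finset.range n, excessSign (k + 1) (Finset.univ.filter fun i => π i ≤ k + 1).card =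
      if IsParkingFunction π then (-1) ^ cosum π else 0 := by
  split_ifs with hπ
  · rw [cosum_eq_sum π hπ, ← Finset.prod_pow_eq_pow_sum]
    refine Finset.prod_congr rfl fun k hk => ?_
    rw [excessSign, if_pos (((isParkingFunction_iff_le_card π).1 hπ).2 k (Finset.mem_range.1 hk))]
  · rw [isParkingFunction_iff_le_card, not_and] at hπ
    obtain ⟨k, hk⟩ := not_forall.1 (hπ h)
    rw [Classical.not_imp] at hk
    exact Finset.prod_eq_zero (Finset.mem_range.2 hk.1) (if_neg hk.2)

/-! ### Partial fillings -/

/-- The functions `φ` on `{0, …, x + v - 1}` with values in `{0, …, v}` and `e < x + φ e` for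
all `e`. The value `v` stands for an element that has not been assigned a value. -/
def partialFillings (x v : ℕ) : Finset (Fin (x + v) → ℕ) :=
  Fintype.piFinset fun e => Finset.Icc ((e : ℕ) + 1 - x) v

theorem mem_partialFillings {x v : ℕ} {φ : Fin (x + v) → ℕ} :
    φ ∈ partialFillings x v ↔ ∀ e : Fin (x + v), (e : ℕ) + 1 - x ≤ φ e ∧ φ e ≤ v := by
  simp [partialFillings]

/-- The product of the signs of the excesses of the numbers of elements with small values. -/
def fillingSign {m : ℕ} (v : ℕ) (φ : Fin m → ℕ) : ℤ :=
  ∏ k ∈ Finset.range v, excessSign (k + 1) (Finset.univ.filter fun e => φ e < k + 1).card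

/-- Extend a partial filling to one more value, leaving precisely the elements of `B` and the new
element unassigned. -/
def extendFilling {m : ℕ} (v : ℕ) (φ : Fin m → ℕ) (B : Finset (Fin m)) : Fin (m + 1) → ℕ :=
  Fin.snoc (α := fun _ => ℕ) (fun e => if e ∈ B then v + 1 else φ e) (v + 1)

@[simp]
theorem extendFilling_castSucc {m : ℕ} (v : ℕ) (φ : Fin m → ℕ) (B : Finset (Fin m)) (e : Fin m) :
    extendFilling v φ B e.castSucc = if e ∈ B then v + 1 else φ e := by
  simp [extendFilling]

@[simp]
theorem extendFilling_last {m : ℕ} (v : ℕ) (φ : Fin m → ℕ) (B : Finset (Fin m)) :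
    extendFilling v φ B (Fin.last m) = v + 1 := by
  simp [extendFilling]

theorem card_extendFilling_eq {m v : ℕ} {φ : Fin m → ℕ} (hφ : ∀ e, φ e ≤ v) (B : Finset (Fin m)) :
    (Finset.univ.filter fun e => extendFilling v φ B e = v + 1).card = B.card + 1 := by
  rw [Finset.card_filter, Fin.sum_univ_castSucc]
  simp only [extendFilling_castSucc, extendFilling_last, if_true]
  rw [← Finset.card_filter]
  congr 2
  ext e
  have := hφ e
  by_cases he : e ∈ B
  · simp [he]
  · simp [he]
    omega

theorem fillingSign_extendFilling {m v : ℕ} {φ : Fin m → ℕ} (hφ : ∀ e, φ e ≤ v)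
    {B : Finset (Fin m)} (hB : B ⊆ Finset.univ.filter fun e => φ e = v) :
    fillingSign (v + 1) (extendFilling v φ B) =
      fillingSign v φ * excessSign (v + 1) (m - B.card) := by
  have hB' : ∀ e ∈ B, φ e = v := fun e he => by simpa using hB he
  rw [fillingSign, Finset.prod_range_succ, fillingSign]
  congr 1
  · refine Finset.prod_congr rfl fun k hk => ?_
    have hk := Finset.mem_range.1 hk
    congr 1
    rw [Finset.card_filter, Fin.sum_univ_castSucc, Finset.card_filter]
    simp only [extendFilling_castSucc, extendFilling_last]
    rw [if_neg (by omega), add_zero]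
    refine Finset.sum_congr rfl fun e _ => ?_
    by_cases he : e ∈ B
    · have := hB' e he
      simp only [he, if_true]
      rw [if_neg (by omega), if_neg (by omega)]
    · simp [he]
  · congr 1
    rw [Finset.card_filter, Fin.sum_univ_castSucc]
    simp only [extendFilling_castSucc, extendFilling_last, lt_irrefl, if_false, add_zero]
    rw [← Finset.card_filter]
    have : (Finset.univ.filter fun e => (if e ∈ B then v + 1 else φ e) < v + 1) = Bᶜ := by
      ext e
      have := hφ e
      by_cases he : e ∈ B
      · simp [he]
      · simp [he]
        omega
    rw [this, Finset.card_compl, Fintype.card_fin]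

theorem extendFilling_min {m v : ℕ} {ψ : Fin (m + 1) → ℕ} (hψ : ∀ e, ψ e ≤ v + 1)
    (hlast : ψ (Fin.last m) = v + 1) :
    extendFilling v (fun e => min (ψ (Fin.castSucc e)) v)
      (Finset.univ.filter fun e => ψ (Fin.castSucc e) = v + 1) = ψ := by
  funext e
  refine Fin.lastCases ?_ (fun e => ?_) e
  · rw [extendFilling_last, hlast]
  · have := hψ e.castSucc
    simp only [extendFilling_castSucc, Finset.mem_filter, Finset.mem_univ, true_and]
    split_ifs <;> omega

/-- The lower bound on the new slot `x + v` is `v + 1`, so it must be unassigned. Among the old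
slots unassigned at stage `v`, those in `B` stay unassigned and the others receive the value `v` for
good. -/
theorem sum_partialFillings_succ_eq_sum_powerset (x v : ℕ) (F : (Fin (x + v + 1) → ℕ) → ℤ) :
    ∑ φ ∈ partialFillings x (v + 1), F φ = ∑ φ ∈ partialFillings x v,
      ∑ B ∈ (Finset.univ.filter fun e => φ e = v).powerset, F (extendFilling v φ B) := by
  rw [Finset.sum_sigma']
  refine Finset.sum_bij'
    (fun ψ _ => (⟨fun e => min (ψ (Fin.castSucc e)) v,
      Finset.univ.filter fun e => ψ (Fin.castSucc e) = v + 1⟩ :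
        (_ : Fin (x + v) → ℕ) × Finset (Fin (x + v))))
    (fun p _ => extendFilling v p.1 p.2) ?_ ?_ ?_ ?_ ?_
  · intro ψ hψ
    have hψ : ∀ e : Fin (x + v + 1), (e : ℕ) + 1 - x ≤ ψ e ∧ ψ e ≤ v + 1 :=
      mem_partialFillings.1 hψ
    simp only [Finset.mem_sigma, mem_partialFillings, Finset.mem_powerset]
    refine ⟨fun e => ?_, fun e he => ?_⟩
    · have := (hψ e.castSucc).1
      simp only [Fin.val_castSucc] at this
      have := e.2
      omega
    · simp only [Finset.mem_filter, Finset.mem_univ, true_and] at he ⊢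
      omega
  · rintro ⟨φ, B⟩ h
    simp only [Finset.mem_sigma, mem_partialFillings, Finset.mem_powerset] at h
    refine mem_partialFillings.2 fun (e : Fin (x + v + 1)) => ?_
    refine Fin.lastCases ?_ (fun e => ?_) e
    · change x + v + 1 - x ≤ extendFilling v φ B (Fin.last (x + v)) ∧
        extendFilling v φ B (Fin.last (x + v)) ≤ v + 1
      rw [extendFilling_last]
      omega
    · have := h.1 e
      have := e.2
      simp only [extendFilling_castSucc, Fin.val_castSucc]
      split_ifs <;> omega
  · intro ψ hψ
    have hψ : ∀ e : Fin (x + v + 1), (e : ℕ) + 1 - x ≤ ψ e ∧ ψ e ≤ v + 1 :=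
      mem_partialFillings.1 hψ
    refine extendFilling_min (fun e => (hψ e).2) ?_
    obtain ⟨h1, h2⟩ := hψ (Fin.last (x + v))
    rw [Fin.val_last] at h1
    exact le_antisymm h2 (le_trans (by omega) h1)
  · rintro ⟨φ, B⟩ h
    simp only [Finset.mem_sigma, mem_partialFillings, Finset.mem_powerset] at h
    have hB : ∀ e ∈ B, φ e = v := fun e he => by simpa using h.2 he
    simp only [extendFilling_castSucc, Sigma.mk.injEq, heq_eq_eq]
    constructor
    · funext e
      have := h.1 e
      split_ifs with he
      · have := hB e he
        omega
      · omega
    · ext e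
      have := h.1 e
      simp only [Finset.mem_filter, Finset.mem_univ, true_and]
      split_ifs with he
      · simp [he]
      · simp only [he, iff_false]
        omega
  · intro ψ hψ
    have hψ : ∀ e : Fin (x + v + 1), (e : ℕ) + 1 - x ≤ ψ e ∧ ψ e ≤ v + 1 :=
      mem_partialFillings.1 hψ
    refine congrArg F (Eq.symm ?_)
    refine extendFilling_min (fun e => (hψ e).2) ?_
    obtain ⟨h1, h2⟩ := hψ (Fin.last (x + v))
    rw [Fin.val_last] at h1
    exact le_antisymm h2 (le_trans (by omega) h1)

/-- With `m` old slots left unassigned, `x + v - m` slots carry values below `v + 1`, an excess of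
`x - 1 - m`. Here `v` cancels, so every stage has the same transfer matrix; `l = x - 1 - m`
reindexes the sum. -/
theorem sum_range_choose_mul_excessSign (x v u : ℕ) (g : ℕ → ℤ) :
    ∑ m ∈ Finset.range (u + 1), u.choose m • (excessSign (v + 1) (x + v - m) * g (m + 1)) =
      ∑ l ∈ Finset.range x, (-1) ^ l * (u.choose (x - 1 - l)) * g (x - l) := by
  have h1 : ∀ m, u.choose m • (excessSign (v + 1) (x + v - m) * g (m + 1)) =
      if m < x ∧ m < u + 1 then (-1 : ℤ) ^ (x - 1 - m) * u.choose m * g (m + 1) else 0 := by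
    intro m
    by_cases hu : m < u + 1
    · by_cases hm : m < x
      · rw [if_pos ⟨hm, hu⟩, excessSign, if_pos (by omega),
          show x + v - m - (v + 1) = x - 1 - m by omega, nsmul_eq_mul]
        ring
      · rw [if_neg (fun h => hm h.1), excessSign, if_neg (by omega)]
        simp
    · rw [if_neg (fun h => hu h.2), Nat.choose_eq_zero_of_lt (by omega)]
      simp
  rw [← Finset.sum_range_reflect (fun l => (-1) ^ l * (u.choose (x - 1 - l) : ℤ) * g (x - l))]
  have h2 : ∑ m ∈ Finset.range x, (-1 : ℤ) ^ (x - 1 - m) * (u.choose (x - 1 - (x - 1 - m))) *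
      g (x - (x - 1 - m)) =
      ∑ m ∈ Finset.range x, u.choose m • (excessSign (v + 1) (x + v - m) * g (m + 1)) := by
    refine Finset.sum_congr rfl fun m hm => ?_
    have hm := Finset.mem_range.1 hm
    rw [h1, show x - 1 - (x - 1 - m) = m by omega, show x - (x - 1 - m) = m + 1 by omega]
    split_ifs with h
    · rfl
    · rw [Nat.choose_eq_zero_of_lt (by omega)]
      simp
  rw [h2]
  have h3 : ∀ N, min x (u + 1) ≤ N →
      ∑ m ∈ Finset.range N, u.choose m • (excessSign (v + 1) (x + v - m) * g (m + 1)) =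
      ∑ m ∈ Finset.range (min x (u + 1)),
        u.choose m • (excessSign (v + 1) (x + v - m) * g (m + 1)) := by
    intro N hN
    refine (Finset.sum_subset (Finset.range_mono hN) fun m _ hm => ?_).symm
    rw [h1, if_neg]
    simp only [Finset.mem_range] at hm
    omega
  rw [h3 _ (min_le_right _ _), h3 _ (min_le_left _ _)]

theorem sum_partialFillings_succ (x v : ℕ) (g : ℕ → ℤ) :
    ∑ φ ∈ partialFillings x (v + 1), fillingSign (v + 1) φ *
        g (Finset.univ.filter fun e => φ e = v + 1).card =
      ∑ φ ∈ partialFillings x v, fillingSign v φ *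
        ∑ l ∈ Finset.range x, (-1) ^ l *
          ((Finset.univ.filter fun e => φ e = v).card.choose (x - 1 - l)) * g (x - l) := by
  refine (sum_partialFillings_succ_eq_sum_powerset x v fun φ : Fin (x + v + 1) → ℕ =>
    fillingSign (v + 1) φ * g (Finset.univ.filter fun e => φ e = v + 1).card).trans ?_
  refine Finset.sum_congr rfl fun φ hφ => ?_
  have hφ' : ∀ e, φ e ≤ v := fun e => (mem_partialFillings.1 hφ e).2
  rw [← sum_range_choose_mul_excessSign x v, ← Finset.sum_powerset_apply_card
    (fun m => excessSign (v + 1) (x + v - m) * g (m + 1)), Finset.mul_sum]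
  refine Finset.sum_congr rfl fun B hB => ?_
  rw [fillingSign_extendFilling hφ' (Finset.mem_powerset.1 hB), card_extendFilling_eq hφ', mul_assoc]

/-- Each induction step trades one stage of the filling for one factor of the matrix, which is why
`k` varies. At `v = 0` the only filling leaves all `x` slots unassigned. -/
theorem sum_partialFillings_transferPow (x v k : ℕ) :
    ∑ φ ∈ partialFillings x v, fillingSign v φ *
        transferPow x k (Finset.univ.filter fun e => φ e = v).card = transferPow x (v + k) x := by
  induction v generalizing k with
  | zero =>
    have : partialFillings x 0 = {fun _ => 0} := by
      ext φ
      simp only [mem_partialFillings, Finset.mem_singleton, funext_iff]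
      refine forall_congr' fun e => ?_
      have := e.2
      omega
    simp [this, fillingSign]
  | succ v ih =>
    rw [sum_partialFillings_succ, add_assoc, add_comm 1 k, ← ih (k + 1)]
    rfl

theorem sum_partialFillings_card_eq (x n : ℕ) :
    ∑ φ ∈ (partialFillings x n).filter
        (fun φ => (Finset.univ.filter fun e => φ e < n).card = n), fillingSign n φ =
      transferPow x n x := by
  have h := sum_partialFillings_transferPow x n 0
  rw [add_zero] at h
  rw [← h, Finset.sum_filter]
  refine Finset.sum_congr rfl fun φ hφ => ?_
  have h1 : (Finset.univ.filter fun e => φ e < n).card +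
      (Finset.univ.filter fun e => φ e = n).card = x + n := by
    have h2 := Finset.card_filter_add_card_filter_not (s := Finset.univ) (fun e => φ e < n)
    rw [Finset.card_univ, Fintype.card_fin] at h2
    refine Eq.trans ?_ h2
    congr 2
    ext e
    have := (mem_partialFillings.1 hφ e).2
    simp
    omega
  simp only [transferPow, mul_ite, mul_one, mul_zero]
  congr 1
  exact propext ⟨by omega, by omega⟩

/-! ### From parking functions to partial fillings -/

/-- All elements of `{0, …, x + n - 1}` except for the `x + i` such that `i` is not an excedance. -/
def excedanceSlots (x : ℕ) {n : ℕ} (π : Fin n → ℕ) : Finset (Fin (x + n)) :=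
  Finset.univ.filter fun e => ∀ i, e = Fin.natAdd x i → (i : ℕ) + 1 < π i

theorem card_excedanceSlots (x : ℕ) {n : ℕ} (π : Fin n → ℕ) :
    (excedanceSlots x π).card = x + exced π := by
  have h1 (a : Fin x) : ∀ i : Fin n, Fin.castAdd n a = Fin.natAdd x i → (i : ℕ) + 1 < π i := by
    intro i h
    have h := congrArg Fin.val h
    simp only [Fin.val_castAdd, Fin.val_natAdd] at h
    have := a.2
    omega
  have h2 (j : Fin n) : (∀ i : Fin n, Fin.natAdd x j = Fin.natAdd x i → (i : ℕ) + 1 < π i) ↔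
      (j : ℕ) + 1 < π j :=
    ⟨fun h => h j rfl, fun h i hi => by rwa [← Fin.natAdd_injective _ _ hi]⟩
  rw [excedanceSlots, Finset.card_filter, Fin.sum_univ_add, exced, Finset.card_filter]
  simp only [h2]
  rw [Finset.sum_congr rfl fun a _ => if_pos (h1 a)]
  simp

/-- If the slot `x + i` lies in `T`, it is made to carry `π i - 1`, so the lower bound `i + 1` on
its value says that `i` is an excedance. The remaining letters fill the slots of `T` below `x`,
where there is no lower bound to meet. -/
theorem sum_words_subset_excedanceSlots (x n : ℕ) (T : Finset (Fin (x + n))) (hT : T.card = n) :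
    ∑ π ∈ (Fintype.piFinset fun _ : Fin n => Finset.Icc 1 n).filter
        (fun π => T ⊆ excedanceSlots x π),
      ∏ k ∈ Finset.range n, excessSign (k + 1) (Finset.univ.filter fun i => π i ≤ k + 1).card =
    ∑ φ ∈ (partialFillings x n).filter (fun φ => (Finset.univ.filter fun e => φ e < n) = T),
      fillingSign n φ := by
  -- The bijection `g` from positions to `T` is arbitrary except that it sends `i` to `x + i`
  -- whenever that slot is in `T`.
  obtain ⟨g, hg⟩ := Finset.exists_equiv_extend_of_card_eq (α := Fin n) (t := T)
    (by simpa using hT.symm) (s := Finset.univ.filter fun i => Fin.natAdd x i ∈ T)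
    (f := Fin.natAdd x) (by intro e; simp; rintro i hi rfl; exact hi)
    (Fin.natAdd_injective _ _).injOn
  have hg' : ∀ i (h : Fin.natAdd x i ∈ T), g.symm ⟨_, h⟩ = i := fun i h => by
    rw [Equiv.symm_apply_eq]
    exact Subtype.ext (hg i (by simpa using h)).symm
  symm
  refine Finset.sum_bij' (fun φ _ i => φ (g i) + 1)
    (fun π _ e => if h : e ∈ T then π (g.symm ⟨e, h⟩) - 1 else n) ?_ ?_ ?_ ?_ ?_
  · intro φ hφ
    simp only [Finset.mem_filter, mem_partialFillings] at hφ
    obtain ⟨h1, h2⟩ := hφ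
    have h3 : ∀ e, φ e < n ↔ e ∈ T := fun e => by rw [← h2]; simp
    simp only [Finset.mem_filter, Fintype.mem_piFinset, Finset.mem_Icc]
    refine ⟨fun i => ?_, fun e he => ?_⟩
    · have := (h3 _).2 (g i).2
      omega
    · simp only [excedanceSlots, Finset.mem_filter, Finset.mem_univ, true_and]
      rintro i rfl
      have h4 := hg i (by simpa using he)
      have := (h1 (Fin.natAdd x i)).1
      rw [h4]
      simp only [Fin.val_natAdd] at this
      omega
  · intro π hπ
    simp only [Finset.mem_filter, Fintype.mem_piFinset, Finset.mem_Icc] at hπ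
    obtain ⟨h1, h2⟩ := hπ
    simp only [Finset.mem_filter, mem_partialFillings]
    refine ⟨fun e => ?_, ?_⟩
    · split_ifs with he
      · have := h1 (g.symm ⟨e, he⟩)
        refine ⟨?_, by omega⟩
        revert he
        refine Fin.addCases (fun a => ?_) (fun i => ?_) e
        · intro he _
          have := a.2
          simp only [Fin.val_castAdd]
          omega
        · intro he _
          rw [hg' i he]
          have h3 := h2 he
          simp only [excedanceSlots, Finset.mem_filter, Finset.mem_univ, true_and] at h3
          have := h3 i rfl
          simp only [Fin.val_natAdd]
          omega
      · have := e.2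
        omega
    · ext e
      simp only [Finset.mem_filter, Finset.mem_univ, true_and]
      split_ifs with he
      · have := h1 (g.symm ⟨e, he⟩)
        simp only [he, iff_true]
        omega
      · simp [he]
  · intro φ hφ
    simp only [Finset.mem_filter, mem_partialFillings] at hφ
    obtain ⟨h1, h2⟩ := hφ
    have h3 : ∀ e, φ e < n ↔ e ∈ T := fun e => by rw [← h2]; simp
    funext e
    split_ifs with he
    · simp
    · have := (h1 e).2
      have := mt (h3 e).1 he
      omega
  · intro π hπ
    simp only [Finset.mem_filter, Fintype.mem_piFinset, Finset.mem_Icc] at hπ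
    funext i
    have := hπ.1 i
    simp
    omega
  · intro φ hφ
    simp only [Finset.mem_filter, mem_partialFillings] at hφ
    obtain ⟨h1, h2⟩ := hφ
    have h3 : ∀ e, φ e < n ↔ e ∈ T := fun e => by rw [← h2]; simp
    refine Finset.prod_congr rfl fun k hk => ?_
    have hk := Finset.mem_range.1 hk
    congr 1
    symm
    refine Finset.card_bij (fun i _ => (g i : Fin (x + n))) ?_ ?_ ?_
    · intro i hi
      simp only [Finset.mem_filter, Finset.mem_univ, true_and] at hi ⊢
      omega
    · intro i _ j _ h
      exact g.injective (Subtype.ext h)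
    · intro e he
      simp only [Finset.mem_filter, Finset.mem_univ, true_and] at he
      refine ⟨g.symm ⟨e, (h3 e).1 (by omega)⟩, ?_, by simp⟩
      simp
      omega

theorem sum_parkingFunctions_choose (x n : ℕ) :
    ∑ π ∈ parkingFunctions n, (-1 : ℤ) ^ cosum π * (x + exced π).choose n = transferPow x n x := by
  rw [← sum_partialFillings_card_eq, ← Finset.sum_fiberwise_of_maps_to (f := fillingSign n)
    (t := Finset.powersetCard n Finset.univ) (g := fun φ => Finset.univ.filter fun e => φ e < n)
    (by intro φ hφ; simp only [Finset.mem_filter] at hφ; simp [Finset.mem_powersetCard, hφ.2])]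
  have h1 : ∀ T ∈ Finset.powersetCard n (Finset.univ : Finset (Fin (x + n))),
      ∑ φ ∈ ((partialFillings x n).filter
        (fun φ => (Finset.univ.filter fun e => φ e < n).card = n)).filter
        (fun φ => (Finset.univ.filter fun e => φ e < n) = T), fillingSign n φ =
      ∑ π ∈ (Fintype.piFinset fun _ : Fin n => Finset.Icc 1 n).filter
        (fun π => T ⊆ excedanceSlots x π), if IsParkingFunction π then (-1) ^ cosum π else 0 := by
    intro T hT
    have hT := (Finset.mem_powersetCard.1 hT).2
    rw [Finset.filter_filter, Finset.filter_congr (q := fun φ =>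
      (Finset.univ.filter fun e => φ e < n) = T) (by
        intro φ _
        exact ⟨fun h => h.2, fun h => ⟨by rw [h, hT], h⟩⟩),
      ← sum_words_subset_excedanceSlots x n T hT]
    refine Finset.sum_congr rfl fun π hπ => prod_excessSign_eq π fun i => ?_
    simp only [Finset.mem_filter, Fintype.mem_piFinset, Finset.mem_Icc] at hπ
    exact (hπ.1 i).1
  rw [Finset.sum_congr rfl h1]
  simp only [Finset.sum_filter]
  rw [Finset.sum_comm, parkingFunctions, Finset.sum_filter]
  refine Finset.sum_congr rfl fun π _ => ?_
  rw [← Finset.sum_filter, Finset.sum_const, ← card_excedanceSlots, ← Finset.card_powersetCard]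
  have : (Finset.powersetCard n Finset.univ).filter (fun T => T ⊆ excedanceSlots x π) =
      Finset.powersetCard n (excedanceSlots x π) := by
    ext T
    simp [Finset.mem_powersetCard, and_comm]
  rw [this]
  split_ifs
  · simp [mul_comm]
  · simp

/-! ### Counting monotone words with prescribed possible equalities -/

/-- The number of elements of `P` before the position `j`. -/
def countBefore {N : ℕ} (P : Finset (Fin N)) (j : Fin (N + 1)) : ℕ :=
  (P.filter fun i => i.castSucc < j).card

theorem countBefore_zero {N : ℕ} (P : Finset (Fin N)) : countBefore P 0 = 0 := by
  simp [countBefore]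

theorem countBefore_last {N : ℕ} (P : Finset (Fin N)) : countBefore P (Fin.last N) = P.card := by
  simp [countBefore, Fin.castSucc_lt_last]

theorem countBefore_succ {N : ℕ} (P : Finset (Fin N)) (i : Fin N) :
    countBefore P i.succ = countBefore P i.castSucc + if i ∈ P then 1 else 0 := by
  have h : (P.filter fun j => j.castSucc < i.succ) =
      (P.filter fun j => j.castSucc < i.castSucc) ∪ P.filter fun j => j = i := by
    ext j
    simp only [Finset.mem_filter, Finset.mem_union, Fin.castSucc_lt_succ_iff,
      Fin.castSucc_lt_castSucc_iff, le_iff_lt_or_eq, and_or_left]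
  rw [countBefore, h, Finset.card_union_of_disjoint, countBefore, Finset.filter_eq']
  · split_ifs <;> simp
  · refine Finset.disjoint_left.2 fun j hj hj' => ?_
    simp only [Finset.mem_filter] at hj hj'
    simp [hj'.2] at hj

/-- The monotone words of length `N + 1` on `m` letters in which only the adjacent letters
at the positions in `P` may be equal. -/
def weakAtWords (m : ℕ) {N : ℕ} (P : Finset (Fin N)) : Finset (Fin (N + 1) → Fin m) :=
  Finset.univ.filter fun c => ∀ i : Fin N,
    c i.castSucc ≤ c i.succ ∧ (c i.castSucc = c i.succ → i ∈ P)

theorem countBefore_le_of_strictMono {N : ℕ} (P : Finset (Fin N)) {d : Fin (N + 1) → ℕ}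
    (hd : StrictMono d) (j : Fin (N + 1)) : countBefore P j ≤ d j := by
  induction j using Fin.induction with
  | zero => simp [countBefore_zero]
  | succ i ih =>
    have := hd (Fin.castSucc_lt_succ (i := i))
    rw [countBefore_succ]
    split_ifs <;> omega

theorem monotone_sub_countBefore {N : ℕ} (P : Finset (Fin N)) {d : Fin (N + 1) → ℕ}
    (hd : StrictMono d) : Monotone fun j => d j - countBefore P j := by
  refine Fin.monotone_iff_le_succ.2 fun i => ?_
  have := hd (Fin.castSucc_lt_succ (i := i))
  simp only [countBefore_succ]
  split_ifs <;> omega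

/-- Adding to each letter the number of elements of `P` before it makes the word strictly
increasing, hence an `(N + 1)`-subset of `range (m + P.card)`; subtracting inverts this. -/
theorem card_weakAtWords (m : ℕ) {N : ℕ} (P : Finset (Fin N)) :
    (weakAtWords m P).card = (m + P.card).choose (N + 1) := by
  have hcard : (Finset.powersetCard (N + 1) (Finset.range (m + P.card))).card =
      (m + P.card).choose (N + 1) := by simp
  rw [← hcard]
  have hmono : ∀ c ∈ weakAtWords m P, StrictMono fun j => (c j : ℕ) + countBefore P j := by
    intro c hc
    simp only [weakAtWords, Finset.mem_filter, Finset.mem_univ, true_and] at hc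
    refine Fin.strictMono_iff_lt_succ.2 fun i => ?_
    obtain ⟨h1, h2⟩ := hc i
    rw [countBefore_succ]
    split_ifs with h
    · have : (c i.castSucc : ℕ) ≤ c i.succ := h1
      omega
    · have : (c i.castSucc : ℕ) < c i.succ := lt_of_le_of_ne h1 fun e => h (h2 (Fin.ext e))
      omega
  refine Finset.card_bij
    (fun c _ => Finset.univ.image fun j => (c j : ℕ) + countBefore P j) ?_ ?_ ?_
  · intro c hc
    rw [Finset.mem_powersetCard, Finset.card_image_of_injective _ (hmono c hc).injective]
    refine ⟨fun y hy => ?_, by simp⟩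
    obtain ⟨j, -, rfl⟩ := Finset.mem_image.1 hy
    have h1 := (hmono c hc).monotone (Fin.le_last j)
    simp only [countBefore_last] at h1
    have := (c (Fin.last N)).2
    rw [Finset.mem_range]
    omega
  · intro c hc c' hc' h
    have hcard' : (Finset.univ.image fun j => (c j : ℕ) + countBefore P j).card = N + 1 := by
      rw [Finset.card_image_of_injective _ (hmono c hc).injective]
      simp
    have e1 := Finset.orderEmbOfFin_unique hcard'
      (fun j => Finset.mem_image_of_mem _ (Finset.mem_univ j)) (hmono c hc)
    have e2 := Finset.orderEmbOfFin_unique hcard'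
      (fun j => by rw [h]; exact Finset.mem_image_of_mem _ (Finset.mem_univ j)) (hmono c' hc')
    funext j
    have := congrFun (e1.trans e2.symm) j
    exact Fin.ext (Nat.add_right_cancel this)
  · intro s hs
    obtain ⟨hs1, hs2⟩ := Finset.mem_powersetCard.1 hs
    set d : Fin (N + 1) → ℕ := ⇑(s.orderEmbOfFin hs2) with hd
    have hd' : StrictMono d := (s.orderEmbOfFin hs2).strictMono
    have hb := countBefore_le_of_strictMono P hd'
    have hm := monotone_sub_countBefore P hd'
    have hlt : ∀ j, d j - countBefore P j < m := by
      intro j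
      refine lt_of_le_of_lt (hm (Fin.le_last j)) ?_
      have h1 := hb (Fin.last N)
      have h2 := Finset.mem_range.1 (hs1 (s.orderEmbOfFin_mem hs2 (Fin.last N)))
      simp only [countBefore_last] at h1 ⊢
      change d _ < _ at h2
      omega
    refine ⟨fun j => ⟨d j - countBefore P j, hlt j⟩, ?_, ?_⟩
    · simp only [weakAtWords, Finset.mem_filter, Finset.mem_univ, true_and]
      refine fun i => ⟨hm (Fin.castSucc_lt_succ (i := i)).le, fun h => ?_⟩
      have h := Fin.mk.inj_iff.1 h
      by_contra hi
      have h1 := hd' (Fin.castSucc_lt_succ (i := i))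
      have h2 := hb i.castSucc
      rw [countBefore_succ, if_neg hi] at h
      omega
    · simp only [Nat.sub_add_cancel (hb _)]
      exact Finset.image_orderEmbOfFin_univ s hs2

/-! ### Alternating words and alternating permutations -/

/-- The words `g` with `g_1 > g_2 < g_3 > ⋯`, of length `n` on `m` letters. -/
def downUpWords (m n : ℕ) : Finset (Fin n → Fin m) :=
  Finset.univ.filter fun g => ∀ (i : Fin n) (h : (i : ℕ) + 1 < n),
    (Even (i : ℕ) → g ⟨(i : ℕ) + 1, h⟩ < g i) ∧ (Odd (i : ℕ) → g i < g ⟨(i : ℕ) + 1, h⟩)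

theorem mem_downUpWords {m N : ℕ} {g : Fin (N + 1) → Fin m} : g ∈ downUpWords m (N + 1) ↔
    ∀ i : Fin N, (Even (i : ℕ) → g i.succ < g i.castSucc) ∧
      (Odd (i : ℕ) → g i.castSucc < g i.succ) := by
  simp only [downUpWords, Finset.mem_filter, Finset.mem_univ, true_and]
  exact ⟨fun h i => h i.castSucc (by simp), fun h i hi => h ⟨i, by omega⟩⟩

theorem mem_alternatingPerms_iff {N : ℕ} {w : Equiv.Perm (Fin (N + 1))} :
    w ∈ alternatingPerms (N + 1) ↔ ∀ i : Fin N, (Even (i : ℕ) → w i.castSucc < w i.succ) ∧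
      (Odd (i : ℕ) → w i.succ < w i.castSucc) := by
  rw [alternatingPerms, Finset.mem_filter]
  simp only [Finset.mem_univ, true_and, IsUpDown]
  exact ⟨fun h i => h i.castSucc (by simp), fun h i hi => h ⟨i, by omega⟩⟩

/-- The positions of the big ascents of `σ`. -/
def bigAscents {N : ℕ} (σ : Equiv.Perm (Fin (N + 1))) : Finset (Fin N) :=
  Finset.univ.filter fun i => (σ i.castSucc : ℕ) + 1 < σ i.succ

theorem bigDes_eq_card_bigAscents {N : ℕ} (τ : Equiv.Perm (Fin (N + 1))) :
    bigDes τ = (bigAscents (τ * Fin.revPerm)).card := by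
  symm
  refine Finset.card_bij (fun i _ => i.rev.castSucc) ?_ ?_ ?_
  · intro i hi
    simp only [bigAscents, Finset.mem_filter, Finset.mem_univ, true_and, Equiv.Perm.mul_apply,
      Fin.revPerm_apply, Fin.rev_castSucc, Fin.rev_succ] at hi
    simp only [Finset.mem_filter, Finset.mem_univ, true_and]
    exact ⟨by simpa using i.pos, hi⟩
  · intro i _ j _ h
    simpa using h
  · intro i hi
    simp only [Finset.mem_filter, Finset.mem_univ, true_and] at hi
    obtain ⟨h1, h2⟩ := hi
    refine ⟨Fin.rev ⟨i, by omega⟩, ?_, by simp⟩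
    simp only [bigAscents, Finset.mem_filter, Finset.mem_univ, true_and, Equiv.Perm.mul_apply,
      Fin.revPerm_apply, Fin.rev_castSucc, Fin.rev_succ, Fin.rev_rev]
    exact h2

theorem monotone_of_mem_weakAtWords {m N : ℕ} {P : Finset (Fin N)} {c : Fin (N + 1) → Fin m}
    (hc : c ∈ weakAtWords m P) : Monotone c := by
  simp only [weakAtWords, Finset.mem_filter, Finset.mem_univ, true_and] at hc
  exact Fin.monotone_iff_le_succ.2 fun i => (hc i).1

/-- Monotonicity makes `c` constant between `a` and `b`, so every step in between is a big ascent of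
`σ`. -/
theorem succ_lt_of_mem_weakAtWords {m N : ℕ} {σ : Equiv.Perm (Fin (N + 1))}
    {c : Fin (N + 1) → Fin m} (hc : c ∈ weakAtWords m (bigAscents σ)) {a b : Fin (N + 1)}
    (hab : a < b) (h : c a = c b) : (σ a : ℕ) + 1 < σ b := by
  have hmono := monotone_of_mem_weakAtWords hc
  simp only [weakAtWords, Finset.mem_filter, Finset.mem_univ, true_and] at hc
  induction b using Fin.induction with
  | zero => exact absurd hab (Fin.not_lt_zero a)
  | succ i ih =>
    have ha : a ≤ i.castSucc := Fin.le_castSucc_iff.2 hab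
    have h1 : c a = c i.castSucc :=
      le_antisymm (hmono ha) (h ▸ hmono (Fin.castSucc_lt_succ (i := i)).le)
    have h2 : (σ i.castSucc : ℕ) + 1 < σ i.succ := by
      simpa [bigAscents] using (hc i).2 (h1.symm.trans h)
    rcases ha.lt_or_eq with hlt | rfl
    · have := ih hlt h1
      omega
    · exact h2

theorem sort_symm_lt_sort_symm {m n : ℕ} {g : Fin n → Fin m} {i j : Fin n} (h : g i < g j) :
    (Tuple.sort g).symm i < (Tuple.sort g).symm j := by
  by_contra hle
  have := Tuple.monotone_sort g (not_lt.1 hle)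
  simp only [Function.comp_apply, Equiv.apply_symm_apply] at this
  exact absurd h (not_lt.2 this)

theorem revPerm_mul_sort_inv_mem_alternatingPerms {m N : ℕ} {g : Fin (N + 1) → Fin m}
    (hg : g ∈ downUpWords m (N + 1)) :
    Fin.revPerm * (Tuple.sort g)⁻¹ ∈ alternatingPerms (N + 1) := by
  rw [mem_downUpWords] at hg
  rw [mem_alternatingPerms_iff]
  simp only [Equiv.Perm.mul_apply, Fin.revPerm_apply, Fin.rev_lt_rev]
  exact fun i => ⟨fun h => sort_symm_lt_sort_symm ((hg i).1 h),
    fun h => sort_symm_lt_sort_symm ((hg i).2 h)⟩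

/-- The fibre over `w` consists of the words with stable sorting permutation `σ = w⁻¹ *
Fin.revPerm`, and sorting them gives exactly `weakAtWords m (bigAscents σ)`. The big ascents of `σ`
are the big descents of `w⁻¹` read backwards. -/
theorem card_downUpWords_sort_eq {m N : ℕ} {w : Equiv.Perm (Fin (N + 1))}
    (hw : w ∈ alternatingPerms (N + 1)) :
    ((downUpWords m (N + 1)).filter fun g => Fin.revPerm * (Tuple.sort g)⁻¹ = w).card =
      (m + bigDes w⁻¹).choose (N + 1) := by
  rw [bigDes_eq_card_bigAscents, ← card_weakAtWords]
  set σ : Equiv.Perm (Fin (N + 1)) := w⁻¹ * Fin.revPerm with hσ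
  have hsort (g : Fin (N + 1) → Fin m) : Fin.revPerm * (Tuple.sort g)⁻¹ = w ↔ σ = Tuple.sort g := by
    rw [hσ, mul_inv_eq_iff_eq_mul, inv_mul_eq_iff_eq_mul]
  have hw' : ∀ i, w i = Fin.rev (σ.symm i) := fun i => by
    rw [hσ]
    change w i = Fin.rev (Fin.rev (w i))
    rw [Fin.rev_rev]
  simp only [hsort]
  refine Finset.card_bij' (fun g _ => g ∘ σ) (fun c _ => c ∘ σ.symm) ?_ ?_ ?_ ?_
  · intro g hg
    obtain ⟨h1, h2⟩ := Finset.mem_filter.1 hg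
    rw [mem_downUpWords] at h1
    obtain ⟨h3, h4⟩ := Tuple.eq_sort_iff.1 h2
    simp only [weakAtWords, Finset.mem_filter, Finset.mem_univ, true_and, bigAscents]
    refine fun i => ⟨h3 (Fin.castSucc_lt_succ (i := i)).le, fun h => ?_⟩
    have h5 : (σ i.castSucc : ℕ) < σ i.succ := h4 _ _ (Fin.castSucc_lt_succ (i := i)) h
    -- Stability only gives an ascent of `σ`. It is big because equal letters of `g` cannot occupy
    -- neighbouring positions of an alternating word.
    refine lt_of_le_of_ne h5 fun h6 => ?_
    have h7 : (σ i.castSucc : ℕ) < N := by omega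
    have h : g (Fin.castSucc ⟨_, h7⟩) = g (Fin.succ ⟨_, h7⟩) :=
      h.trans (congrArg g (Fin.ext h6.symm))
    have h8 := h1 ⟨_, h7⟩
    rcases Nat.even_or_odd (σ i.castSucc : ℕ) with he | ho
    · exact (h8.1 he).ne' h
    · exact (h8.2 ho).ne h
  · intro c hc
    have hmono := monotone_of_mem_weakAtWords hc
    rw [mem_alternatingPerms_iff] at hw
    simp only [hw', Fin.rev_lt_rev] at hw
    refine Finset.mem_filter.2 ⟨mem_downUpWords.2 fun i => ⟨fun he => ?_, fun ho => ?_⟩,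
      Tuple.eq_sort_iff.2 ⟨?_, fun a b hab h => ?_⟩⟩
    · have h1 := (hw i).1 he
      refine lt_of_le_of_ne (hmono h1.le) fun h => ?_
      have := succ_lt_of_mem_weakAtWords hc h1 h
      simp at this
      omega
    · have h1 := (hw i).2 ho
      refine lt_of_le_of_ne (hmono h1.le) fun h => ?_
      have := succ_lt_of_mem_weakAtWords hc h1 h
      simp at this
    · simpa [Function.comp_assoc] using hmono
    · simp only [Function.comp_apply, Equiv.symm_apply_apply] at h
      have := succ_lt_of_mem_weakAtWords hc hab h
      exact Fin.lt_def.2 (by omega)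
  · intro g _
    simp [Function.comp_assoc]
  · intro c _
    simp [Function.comp_assoc]

theorem sum_alternatingPerms_choose (m N : ℕ) :
    ∑ w ∈ alternatingPerms (N + 1), (m + bigDes w⁻¹).choose (N + 1) =
      (downUpWords m (N + 1)).card := by
  rw [Finset.card_eq_sum_card_fiberwise (t := alternatingPerms (N + 1))
    (f := fun g => Fin.revPerm * (Tuple.sort g)⁻¹)
    fun g hg => revPerm_mul_sort_inv_mem_alternatingPerms hg]
  exact Finset.sum_congr rfl fun w hw => (card_downUpWords_sort_eq hw).symm

/-- The words of length `k + 1` on the letters `0, …, x` all of whose pairs of adjacent letters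
have a sum less than `x`. -/
def zigzagWords (x k : ℕ) : Finset (Fin (k + 1) → Fin (x + 1)) :=
  Finset.univ.filter fun a => ∀ i : Fin k, (a i.castSucc : ℕ) + a i.succ < x

theorem card_zigzagWords_head (x k : ℕ) : ∀ b ≤ x,
    ((zigzagWords x k).filter fun a => (a 0 : ℕ) = b).card = zigzagCount x k b := by
  induction k with
  | zero =>
    intro b hb
    refine Finset.card_eq_one.2 ⟨fun _ => ⟨b, by omega⟩, ?_⟩
    ext a
    simp only [zigzagWords, IsEmpty.forall_iff, Finset.filter_true, Finset.mem_filter,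
      Finset.mem_univ, true_and, Finset.mem_singleton, funext_iff, Fin.ext_iff]
    exact ⟨fun h i => by rw [← h, Fin.fin_one_eq_zero i], fun h => h 0⟩
  | succ k ih =>
    intro b hb
    rw [zigzagCount, Finset.card_eq_sum_card_fiberwise (t := Finset.range (x - b))
      (f := fun a => (a 1 : ℕ))]
    · refine Finset.sum_congr rfl fun j hj => ?_
      have hj := Finset.mem_range.1 hj
      rw [← ih j (by omega)]
      refine Finset.card_bij' (fun a _ => Fin.tail a)
        (fun a _ => Fin.cons (α := fun _ => Fin (x + 1)) ⟨b, by omega⟩ a) ?_ ?_ ?_ ?_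
      · intro a ha
        simp only [zigzagWords, Finset.mem_filter, Finset.mem_univ, true_and] at ha ⊢
        exact ⟨fun i => ha.1.1 i.succ, ha.2⟩
      · intro a ha
        simp only [zigzagWords, Finset.mem_filter, Finset.mem_univ, true_and] at ha ⊢
        refine ⟨⟨fun i => ?_, by simp⟩, ?_⟩
        · refine Fin.cases ?_ (fun i => ?_) i
          · simp
            omega
          · simpa using ha.1 i
        · exact ha.2
      · intro a ha
        simp only [zigzagWords, Finset.mem_filter, Finset.mem_univ, true_and] at ha
        refine (congrArg (fun y => Fin.cons (α := fun _ => Fin (x + 1)) y (Fin.tail a))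
          (Fin.ext ha.1.2.symm)).trans (Fin.cons_self_tail a)
      · intro a _
        exact Fin.tail_cons _ _
    · intro a ha
      simp only [zigzagWords, Finset.coe_filter, Finset.mem_filter, Finset.mem_univ, true_and,
        Set.mem_ofPred_eq] at ha
      have := ha.1 0
      simp only [Fin.castSucc_zero, Fin.succ_zero_eq_one] at this
      simp
      omega

/-- Prepending the letter `0` is allowed exactly when the first letter is less than `x`. This is
automatic once the word has at least two letters, and would fail for the one-letter word `x`. -/
theorem card_zigzagWords (x k : ℕ) : (zigzagWords x (k + 1)).card = zigzagCount x (k + 2) 0 := by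
  rw [zigzagCount, Finset.card_eq_sum_card_fiberwise (t := Finset.range (x - 0))
    (f := fun a => (a 0 : ℕ))]
  · exact Finset.sum_congr rfl fun j hj =>
      card_zigzagWords_head x (k + 1) j (by simp at hj; omega)
  · intro a ha
    simp only [zigzagWords, Finset.coe_filter, Finset.mem_univ, true_and, Set.mem_ofPred_eq] at ha
    have := ha 0
    simp only [Fin.castSucc_zero] at this
    simp
    omega

/-- Reverse the order of the letters at the even positions. -/
def flipEven {m n : ℕ} (g : Fin n → Fin m) (i : Fin n) : Fin m :=
  if Even (i : ℕ) then (g i).rev else g i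

theorem flipEven_flipEven {m n : ℕ} (g : Fin n → Fin m) : flipEven (flipEven g) = g := by
  funext i
  simp only [flipEven]
  split_ifs <;> simp

theorem flipEven_mem_zigzagWords {x k : ℕ} {g : Fin (k + 1) → Fin (x + 1)} :
    flipEven g ∈ zigzagWords x k ↔ g ∈ downUpWords (x + 1) (k + 1) := by
  rw [mem_downUpWords]
  simp only [zigzagWords, Finset.mem_filter, Finset.mem_univ, true_and]
  refine forall_congr' fun i => ?_
  have h1 := (g i.castSucc).2
  have h2 := (g i.succ).2
  rcases Nat.even_or_odd (i : ℕ) with h | h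
  · have h' : ¬ Odd (i : ℕ) := Nat.not_odd_iff_even.2 h
    simp only [flipEven, Fin.val_castSucc, Fin.val_succ, h, Nat.even_add_one, h', not_true,
      if_true, if_false, true_imp_iff, false_imp_iff, and_true, Fin.lt_def, Fin.val_rev]
    omega
  · have h' : ¬ Even (i : ℕ) := Nat.not_even_iff_odd.2 h
    simp only [flipEven, Fin.val_castSucc, Fin.val_succ, h, Nat.even_add_one, h', not_false_iff,
      if_true, if_false, true_imp_iff, false_imp_iff, true_and, Fin.lt_def, Fin.val_rev]
    omega

theorem card_downUpWords (x k : ℕ) :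
    (downUpWords (x + 1) (k + 2)).card = zigzagCount x (k + 2) 0 := by
  rw [← card_zigzagWords]
  refine Finset.card_bij' (fun g _ => flipEven g) (fun a _ => flipEven a)
    (fun g hg => flipEven_mem_zigzagWords.2 hg) (fun a ha => ?_)
    (fun g _ => flipEven_flipEven g) (fun a _ => flipEven_flipEven a)
  rw [← flipEven_mem_zigzagWords, flipEven_flipEven]
  exact ha

/-! ### The main theorem -/

theorem exced_le {n : ℕ} (π : Fin n → ℕ) : exced π ≤ n :=
  (Finset.card_filter_le _ _).trans (by simp)

theorem bigDes_add_one_le {N : ℕ} (τ : Equiv.Perm (Fin (N + 1))) : bigDes τ + 1 ≤ N + 1 := by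
  rw [bigDes_eq_card_bigAscents]
  exact Nat.succ_le_succ ((Finset.card_filter_le _ _).trans (by simp))

theorem eval_neg_one_parkingEnumerator (n : ℕ) : (parkingEnumerator n).eval (-1 : ℤ[X]) =
    ∑ π ∈ parkingFunctions n, ((-1 : ℤ) ^ cosum π) • (X : ℤ[X]) ^ exced π := by
  simp [parkingEnumerator, eval_finsetSum, zsmul_eq_mul]

theorem theorem3p6 (n : ℕ) (hn : 2 ≤ n) :
    (parkingEnumerator n).eval (-1 : ℤ[X]) =
      ∑ w ∈ alternatingPerms n, (X : ℤ[X]) ^ (bigDes w⁻¹ + 1) := by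
  obtain ⟨k, rfl⟩ : ∃ k, n = k + 2 := ⟨n - 2, by omega⟩
  rw [eval_neg_one_parkingEnumerator]
  refine eq_of_binomialFunctional_eq (n := k + 2) ?_ ?_ fun x => ?_
  · refine natDegree_sum_le_of_forall_le _ _ fun π _ => (natDegree_smul_le _ _).trans ?_
    simpa using exced_le π
  · refine natDegree_sum_le_of_forall_le _ _ fun w _ => ?_
    simpa using bigDes_add_one_le w⁻¹
  · have h1 : ∀ π ∈ parkingFunctions (k + 2),
        binomialFunctional (k + 2) x (((-1 : ℤ) ^ cosum π) • (X : ℤ[X]) ^ exced π) =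
        (-1 : ℤ) ^ cosum π * (x + exced π).choose (k + 2) := fun π _ => by
      rw [map_smul, binomialFunctional_X_pow x (exced_le π), smul_eq_mul]
    have h2 : ∀ w ∈ alternatingPerms (k + 2),
        binomialFunctional (k + 2) x ((X : ℤ[X]) ^ (bigDes w⁻¹ + 1)) =
        ((x + 1 + bigDes w⁻¹).choose (k + 2) : ℕ) := fun w _ => by
      -- The extra `1` in the exponent of `t` is absorbed into the size `x + 1` of the alphabet.
      rw [binomialFunctional_X_pow x (bigDes_add_one_le w⁻¹), add_right_comm x 1, add_assoc x]
    rw [map_sum, map_sum, Finset.sum_congr rfl h1, Finset.sum_congr rfl h2,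
      sum_parkingFunctions_choose, ← Nat.cast_sum, sum_alternatingPerms_choose, card_downUpWords,
      zigzagCount_zero_eq_transferPow]
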